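/- Consider a status update system with $N$ sources and a server that never idles. At every scheduling instance (the first one at time $0$, each next one at the end of the preceding transmission) source $n$ is selected with probability $\eta_n>0$, $\sum_{n=1}^N\eta_n=1$; it generates a packet and transmits it during a service time distributed as $S_n\ge 0$, with mean $s_n=\mathbb E[S_n]>0$ and second moment $q_n=\mathbb E[S_n^2]<\infty$. The packet is received at the end of its transmission, unless it is dropped, which happens with probability $p_n\in[0,1)$, independently of its service time; different scheduling instances are i.i.d. This is the P-GAW scheduler with selection probabilities $\eta_n$ and drop probabilities $p_n$; it is drop-free if all drop probabilities are $0$. The age of source $n$ at time $t$ is $\Delta_n(t)=t-g_n(t)$, where $g_n(t)$ is the generation time of the freshest packet of source $n$ received by time $t$ (with arbitrary deterministic initial ages $\Delta_n(0)\ge 0$). The mean AoI $\mathbb E[\Delta_n]$ is the almost sure limit of $\frac1T\int_0^T\Delta_n(t)\,dt$ as $T\to\infty$, and the weighted AoI with weights $w_n$ is the almost sure limit of $\frac1T\int_0^T\sum_n w_n\Delta_n(t)\,dt$, which equals $\sum_n w_n\mathbb E[\Delta_n]$. Put $\eta'_n=\eta_n(1-p_n)$ for $1\le n\le N$, $\eta'_{N+1}=\sum_{n=1}^N\eta_np_n$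 and, if $\eta'_{N+1}>0$, $$s_{N+1}=\frac1{\eta'_{N+1}}\sum_{n=1}^N\eta_np_ns_n,\qquad q_{N+1}=\frac1{\eta'_{N+1}}\sum_{n=1}^N\eta_np_nq_n .$$ Then: 1. At every scheduling instance, $\eta'_n$ is the probability that source $n$ is selected and its packet is received, and $\eta'_{N+1}$ is the probability that the packet is dropped. 2. If $\eta'_{N+1}>0$, then the service time of a transmission, conditioned on its being dropped, has mean $s_{N+1}$ and second moment $q_{N+1}$, and if every dropped transmission is attributed to an additional (phantom) source $N+1$ as a successful one, the result is a drop-free P-GAW scheduler with $N+1$ sources, selection probabilities $\eta'_1,\dots,\eta'_{N+1}$, the original service time distributions for sources $1,\dots,N$, and this conditional distribution for source $N+1$. 3. The mean AoI of every source and, for all real weights $w_1,\dots,w_N$, the weighted AoI of the $N$-source P-GAW scheduler with selection probabilities $\eta_n$ and drop probabilities $p_n$ exist as finite deterministic limits. They are equal to the mean AoI of sources $1,\dots,N$ and to the weighted AoI, with the same weights $w_1,\dots,w_N$ and weight $0$ for the phantom source, of every drop-free $(N+1)$-source P-GAW scheduler with selection probabilities $\eta'_1,\dots,\eta'_{N+1}$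 whose nonnegative service times have first and second moments $s_n,q_n$ for $1\le n\le N$ and, if $\eta'_{N+1}>0$, $s_{N+1},q_{N+1}$ for the phantom source (if $\eta'_{N+1}=0$, the phantom source is never selected and its service time may be any with positive mean and finite second moment). -/

import Mathlib

open MeasureTheory ProbabilityTheory Filter Topology
open scoped NNReal ENNReal

noncomputable section

namespace PGAW

/-- What happens at one scheduling instance of an `N`-source system: the selected source, the
service time of its packet, and whether the packet is dropped (`true`) or received (`false`). -/
abbrev Slot (N : ℕ) : Type := Fin N × ℝ × Bool

/-- First moment of a law on `ℝ`. -/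
def mean (σ : Measure ℝ) : ℝ := ∫ x, x ∂σ

/-- Second moment of a law on `ℝ`. -/
def secondMoment (σ : Measure ℝ) : ℝ := ∫ x, x ^ 2 ∂σ

/-- `σ` is the law of a service time: a nonnegative random variable with positive mean and finite
second moment. -/
structure IsServiceLaw (σ : Measure ℝ) : Prop where
  isProb : IsProbabilityMeasure σ
  nonneg : ∀ᵐ x ∂σ, 0 ≤ x
  memLp : MemLp (fun x : ℝ => x) 2 σ
  mean_pos : 0 < mean σ

/-- The law of a drop indicator which equals `true` with probability `p`. -/
def dropLaw (p : ℝ) : Measure Bool :=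
  ENNReal.ofReal p • Measure.dirac true + ENNReal.ofReal (1 - p) • Measure.dirac false

/-- The law of one scheduling instance: source `n` is selected with probability `η n`; given this,
the service time has law `σ n` and the packet is dropped with probability `p n`, independently of
its service time. -/
def slotLaw {N : ℕ} (η p : Fin N → ℝ) (σ : Fin N → Measure ℝ) : Measure (Slot N) :=
  ∑ n, ENNReal.ofReal (η n) • (Measure.dirac n).prod ((σ n).prod (dropLaw (p n)))

/-- The sequence `X` of scheduling instances, on the probability space `(Ω, P)`, is governed by a
P-GAW scheduler with selection probabilities `η`, drop probabilities `p` and service time laws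
`σ`: the scheduling instances are i.i.d. with law `slotLaw η p σ`. -/
structure IsPGAW {N : ℕ} {Ω : Type*} [MeasurableSpace Ω] (P : Measure Ω)
    (η p : Fin N → ℝ) (σ : Fin N → Measure ℝ) (X : ℕ → Ω → Slot N) : Prop where
  prob_nonneg : ∀ n, 0 ≤ η n
  prob_sum : ∑ n, η n = 1
  drop_nonneg : ∀ n, 0 ≤ p n
  drop_le_one : ∀ n, p n ≤ 1
  service : ∀ n, IsServiceLaw (σ n)
  measurable : ∀ k, Measurable (X k)
  indep : iIndepFun X P
  law : ∀ k, P.map (X k) = slotLaw η p σ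

/-- The time at which the `k`-th scheduling instance starts (counting from `k = 0`, at time `0`).
The server never idles, so this is the total service time of the preceding instances, and the
`k`-th transmission ends at `slotStart x (k + 1)`. -/
def slotStart {N : ℕ} (x : ℕ → Slot N) (k : ℕ) : ℝ := ∑ j ∈ Finset.range k, (x j).2.1

/-- The generation time of the freshest update of source `n` that was received by time `t`. A
packet is generated when its transmission starts and is received, unless it is dropped, when its
transmission ends. The update available initially was generated at time `g₀`. -/
def freshestGen {N : ℕ} (x : ℕ → Slot N) (g₀ : ℝ) (n : Fin N) (t : ℝ) : ℝ :=
  sSup (insert g₀ {g : ℝ | ∃ k, (x k).1 = n ∧ (x k).2.2 = false ∧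
    slotStart x (k + 1) ≤ t ∧ g = slotStart x k})

/-- The age of information of source `n` at time `t`, with initial ages `a₀`. -/
def age {N : ℕ} (x : ℕ → Slot N) (a₀ : Fin N → ℝ≥0) (n : Fin N) (t : ℝ) : ℝ :=
  t - freshestGen x (-(a₀ n : ℝ)) n t

/-- `a` is the long-run time average of the function `f` on `[0, ∞)`. -/
def IsTimeAverage (f : ℝ → ℝ) (a : ℝ) : Prop :=
  (∀ T, 0 ≤ T → IntervalIntegrable f volume 0 T) ∧
    Tendsto (fun T : ℝ => (∫ t in (0 : ℝ)..T, f t) / T) atTop (𝓝 a)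

/-- The mean AoI of source `n` is `a`: almost surely, `a` is the time average of its age process. -/
def HasMeanAoI {N : ℕ} {Ω : Type*} [MeasurableSpace Ω] (P : Measure Ω) (X : ℕ → Ω → Slot N)
    (a₀ : Fin N → ℝ≥0) (n : Fin N) (a : ℝ) : Prop :=
  ∀ᵐ ω ∂P, IsTimeAverage (fun t => age (fun k => X k ω) a₀ n t) a

/-- The weighted AoI with weights `w` is `D`: almost surely, `D` is the time average of the
weighted sum of the age processes of all the sources. -/
def HasWeightedAoI {N : ℕ} {Ω : Type*} [MeasurableSpace Ω] (P : Measure Ω) (X : ℕ → Ω → Slot N)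
    (a₀ : Fin N → ℝ≥0) (w : Fin N → ℝ) (D : ℝ) : Prop :=
  ∀ᵐ ω ∂P, IsTimeAverage (fun t => ∑ n, w n * age (fun k => X k ω) a₀ n t) D

/-- The probability that a scheduling instance results in a drop. -/
def phantomWeight {N : ℕ} (η p : Fin N → ℝ) : ℝ := ∑ n, η n * p n

/-- The selection probabilities of the phantom-expanded system; `Fin.last N` is the phantom. -/
def phantomProb {N : ℕ} (η p : Fin N → ℝ) : Fin (N + 1) → ℝ :=
  Fin.snoc (fun n => η n * (1 - p n)) (phantomWeight η p)

/-- First moment of the service time of the phantom source. -/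
def phantomMean {N : ℕ} (η p : Fin N → ℝ) (σ : Fin N → Measure ℝ) : ℝ :=
  1 / phantomWeight η p * ∑ n, η n * p n * mean (σ n)

/-- Second moment of the service time of the phantom source. -/
def phantomSecondMoment {N : ℕ} (η p : Fin N → ℝ) (σ : Fin N → Measure ℝ) : ℝ :=
  1 / phantomWeight η p * ∑ n, η n * p n * secondMoment (σ n)

/-- Attribute every dropped transmission to the phantom source, as a successful one. -/
def relabel {N : ℕ} (y : Slot N) : Slot (N + 1) :=
  (if y.2.2 = true then Fin.last N else y.1.castSucc, y.2.1, false)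

end PGAW

end

/-! The long-run age of source `n` depends on the scheduler only through three numbers: the
reception probability `α = η n * (1 - p n)` and the moments `m`, `Q` of the service time of a
scheduling instance. Its mean is `m / α + Q / (2 * m)` (`IsPGAW.hasMeanAoI`). Renaming drops as
phantom receptions preserves `α`, and `m`, `Q` as well, since `∑ η n * p n * f n` merely moves into
the phantom term (`sum_phantomProb_mul`). Matching moments thus suffice, and the two systems need
not share a probability space.

For the formula, let `A k` be the age at the start of slot `k`, `S k` its service time and `r k` the
reception indicator. Then `A (k + 1) = (1 - r k) * A k + S k`, and the age has integral `A k * S k +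
S k ^ 2 / 2` over the slot. Since `A k` is independent of slot `k` and bounded in L², the products
of `A k` with the centered variables `r k - α` and `S k - m` are orthogonal and bounded in L², so
their averages vanish almost surely (`strong_law_of_orthogonal`). Telescoping the recursion gives
average `m / α` for `A k`, hence `m ^ 2 / α + Q / 2` per slot for the integral; division by the mean
slot length `m` concludes (`isTimeAverage_age`). -/

noncomputable section

namespace PGAW

/-! ### Integration against the law of one scheduling instance -/

section SlotLaw

variable {N : ℕ} {η p : Fin N → ℝ} {σ : Fin N → Measure ℝ}

theorem slotLaw_eq (η p : Fin N → ℝ) (σ : Fin N → Measure ℝ) [∀ n, SFinite (σ n)] :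
    slotLaw η p σ = ∑ n, ENNReal.ofReal (η n) •
      (ENNReal.ofReal (p n) • (σ n).map (fun x => ((n, x, true) : Slot N)) +
        ENNReal.ofReal (1 - p n) • (σ n).map (fun x => ((n, x, false) : Slot N))) := by
  refine Finset.sum_congr rfl fun n _ => ?_
  have h : ∀ b : Bool, Measurable fun x : ℝ => (x, b) := fun b => by fun_prop
  rw [dropLaw, Measure.prod_add, Measure.prod_smul_right, Measure.prod_smul_right,
    Measure.prod_dirac, Measure.prod_dirac, Measure.dirac_prod, Measure.map_add _ _ (by fun_prop),
    Measure.map_smul, Measure.map_smul, Measure.map_map (by fun_prop) (h _),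
    Measure.map_map (by fun_prop) (h _)]
  rfl

theorem slotLaw_apply [∀ n, SFinite (σ n)] {s : Set (Slot N)} (hs : MeasurableSet s) :
    slotLaw η p σ s = ∑ n, ENNReal.ofReal (η n) *
      (ENNReal.ofReal (p n) * σ n {x | (n, x, true) ∈ s} +
        ENNReal.ofReal (1 - p n) * σ n {x | (n, x, false) ∈ s}) := by
  rw [slotLaw_eq, Measure.finsetSum_apply]
  refine Finset.sum_congr rfl fun n _ => ?_
  rw [Measure.smul_apply, Measure.add_apply, Measure.smul_apply, Measure.smul_apply,
    Measure.map_apply (by fun_prop) hs, Measure.map_apply (by fun_prop) hs]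
  rfl

theorem integrable_slotLaw [∀ n, SFinite (σ n)] {f : Slot N → ℝ} (hf : Measurable f)
    (hi : ∀ n b, Integrable (fun x => f (n, x, b)) (σ n)) :
    Integrable f (slotLaw η p σ) := by
  rw [slotLaw_eq, integrable_finsetSum_measure]
  have h : ∀ n b, Integrable f ((σ n).map fun x => ((n, x, b) : Slot N)) := fun n b =>
    (integrable_map_measure hf.aestronglyMeasurable (by fun_prop)).2 (hi n b)
  exact fun n _ => (((h n true).smul_measure ENNReal.ofReal_ne_top).add_measure
    ((h n false).smul_measure ENNReal.ofReal_ne_top)).smul_measure ENNReal.ofReal_ne_top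

theorem integral_slotLaw [∀ n, SFinite (σ n)] (hη : ∀ n, 0 ≤ η n) (hp0 : ∀ n, 0 ≤ p n)
    (hp1 : ∀ n, p n ≤ 1) {f : Slot N → ℝ} (hf : Measurable f)
    (hi : ∀ n b, Integrable (fun x => f (n, x, b)) (σ n)) :
    ∫ y, f y ∂(slotLaw η p σ) = ∑ n, η n *
      (p n * ∫ x, f (n, x, true) ∂(σ n) + (1 - p n) * ∫ x, f (n, x, false) ∂(σ n)) := by
  have h : ∀ n b, Integrable f ((σ n).map fun x => ((n, x, b) : Slot N)) := fun n b =>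
    (integrable_map_measure hf.aestronglyMeasurable (by fun_prop)).2 (hi n b)
  have h' : ∀ n b (c : ℝ), Integrable f
      (ENNReal.ofReal c • (σ n).map fun x => ((n, x, b) : Slot N)) := fun n b c =>
    (h n b).smul_measure ENNReal.ofReal_ne_top
  rw [slotLaw_eq, integral_finsetSum_measure fun n _ =>
    ((h' n _ _).add_measure (h' n _ _)).smul_measure ENNReal.ofReal_ne_top]
  refine Finset.sum_congr rfl fun n _ => ?_
  rw [integral_smul_measure, integral_add_measure (h' n _ _) (h' n _ _), integral_smul_measure,
    integral_smul_measure, integral_map (by fun_prop) hf.aestronglyMeasurable,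
    integral_map (by fun_prop) hf.aestronglyMeasurable, ENNReal.toReal_ofReal (hη n),
    ENNReal.toReal_ofReal (hp0 n), ENNReal.toReal_ofReal (sub_nonneg.2 (hp1 n))]
  rfl

theorem measurable_relabel : Measurable (relabel : Slot N → Slot (N + 1)) := by
  unfold relabel
  refine Measurable.prodMk (Measurable.ite ?_ measurable_const ?_) (by fun_prop)
  · exact (measurable_snd.comp measurable_snd) (measurableSet_singleton true)
  · exact (measurable_of_finite Fin.castSucc).comp measurable_fst

theorem measurableSet_dropped : MeasurableSet {y : Slot N | y.2.2 = true} :=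
  (measurable_snd.comp measurable_snd) (measurableSet_singleton true)

theorem measurableSet_received (n : Fin N) :
    MeasurableSet {y : Slot N | y.1 = n ∧ y.2.2 = false} :=
  (measurable_fst (measurableSet_singleton n)).inter
    ((measurable_snd.comp measurable_snd) (measurableSet_singleton false))

end SlotLaw

/-! ### The phantom service law -/

section Phantom

variable {N : ℕ} {η p : Fin N → ℝ} {σ : Fin N → Measure ℝ}

/-- The law of the service time of a transmission, given that it is dropped. -/
def phantomLaw (η p : Fin N → ℝ) (σ : Fin N → Measure ℝ) : Measure ℝ :=
  ∑ n, ENNReal.ofReal (η n * p n / phantomWeight η p) • σ n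

theorem IsServiceLaw.integrable_id {σ : Measure ℝ} (h : IsServiceLaw σ) :
    Integrable (fun x : ℝ => x) σ :=
  have := h.isProb
  h.memLp.integrable (by norm_num)

theorem IsServiceLaw.integrable_sq {σ : Measure ℝ} (h : IsServiceLaw σ) :
    Integrable (fun x : ℝ => x ^ 2) σ := h.memLp.integrable_sq

theorem integral_phantomLaw (hη : ∀ n, 0 ≤ η n) (hp : ∀ n, 0 ≤ p n)
    (hw : 0 < phantomWeight η p) {f : ℝ → ℝ} (hf : ∀ n, Integrable f (σ n)) :
    ∫ x, f x ∂(phantomLaw η p σ) =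
      1 / phantomWeight η p * ∑ n, η n * p n * ∫ x, f x ∂(σ n) := by
  rw [phantomLaw, integral_finsetSum_measure fun n _ =>
    (hf n).smul_measure ENNReal.ofReal_ne_top, Finset.mul_sum]
  refine Finset.sum_congr rfl fun n _ => ?_
  rw [integral_smul_measure, ENNReal.toReal_ofReal
    (div_nonneg (mul_nonneg (hη n) (hp n)) hw.le), smul_eq_mul]
  ring

theorem mean_phantomLaw (hη : ∀ n, 0 ≤ η n) (hp : ∀ n, 0 ≤ p n)
    (hσ : ∀ n, IsServiceLaw (σ n)) (hw : 0 < phantomWeight η p) :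
    mean (phantomLaw η p σ) = phantomMean η p σ :=
  integral_phantomLaw hη hp hw fun n => (hσ n).integrable_id

theorem secondMoment_phantomLaw (hη : ∀ n, 0 ≤ η n) (hp : ∀ n, 0 ≤ p n)
    (hσ : ∀ n, IsServiceLaw (σ n)) (hw : 0 < phantomWeight η p) :
    secondMoment (phantomLaw η p σ) = phantomSecondMoment η p σ :=
  integral_phantomLaw hη hp hw fun n => (hσ n).integrable_sq

theorem isServiceLaw_phantomLaw (hη : ∀ n, 0 ≤ η n) (hp : ∀ n, 0 ≤ p n)
    (hσ : ∀ n, IsServiceLaw (σ n)) (hw : 0 < phantomWeight η p) :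
    IsServiceLaw (phantomLaw η p σ) where
  isProb := by
    constructor
    have h1 : ∀ n, σ n Set.univ = 1 := fun n => (hσ n).isProb.measure_univ
    simp only [phantomLaw, Measure.finsetSum_apply, Measure.smul_apply, h1, smul_eq_mul, mul_one]
    rw [← ENNReal.ofReal_sum_of_nonneg fun n _ => div_nonneg (mul_nonneg (hη n) (hp n)) hw.le,
      ← Finset.sum_div]
    rw [show ∑ n, η n * p n = phantomWeight η p from rfl, div_self hw.ne', ENNReal.ofReal_one]
  nonneg := by
    rw [phantomLaw, ae_iff, Measure.finsetSum_apply]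
    refine Finset.sum_eq_zero fun n _ => ?_
    rw [Measure.smul_apply, ae_iff.1 (hσ n).nonneg, smul_zero]
  memLp := by
    refine (memLp_two_iff_integrable_sq aestronglyMeasurable_id).2 ?_
    rw [phantomLaw, integrable_finsetSum_measure]
    exact fun n _ => (hσ n).integrable_sq.smul_measure ENNReal.ofReal_ne_top
  mean_pos := by
    rw [mean_phantomLaw hη hp hσ hw]
    refine mul_pos (one_div_pos.2 hw) ?_
    -- A positive drop probability forces some source with `η n * p n > 0`; its mean makes the sum
    -- positive.
    obtain ⟨n, -, hn⟩ := Finset.exists_lt_of_sum_lt (s := Finset.univ) (f := fun _ : Fin N => (0 : ℝ))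
      (g := fun n => η n * p n) (by simpa [phantomWeight] using hw)
    exact Finset.sum_pos' (fun m _ => mul_nonneg (mul_nonneg (hη m) (hp m)) (hσ m).mean_pos.le)
      ⟨n, Finset.mem_univ n, mul_pos hn (hσ n).mean_pos⟩

/-- The phantom's share is `phantomWeight` times a mixture normalised by `phantomWeight`, so the
normalisation cancels and the dropped part of the original law remains. -/
theorem map_relabel_slotLaw (hη : ∀ n, 0 ≤ η n) (hp : ∀ n, 0 ≤ p n)
    (hσ : ∀ n, IsServiceLaw (σ n)) (hw : 0 < phantomWeight η p) :
    (slotLaw η p σ).map relabel = slotLaw (phantomProb η p) (fun _ => 0)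
      (Fin.snoc σ (phantomLaw η p σ) : Fin (N + 1) → Measure ℝ) := by
  have : ∀ n, IsProbabilityMeasure (σ n) := fun n => (hσ n).isProb
  have := (isServiceLaw_phantomLaw hη hp hσ hw).isProb
  have : ∀ n, SFinite ((Fin.snoc σ (phantomLaw η p σ) : Fin (N + 1) → Measure ℝ) n) := by
    intro n
    refine Fin.lastCases ?_ (fun n => ?_) n
    · rw [Fin.snoc_last]; infer_instance
    · rw [Fin.snoc_castSucc]; infer_instance
  ext s hs
  rw [Measure.map_apply measurable_relabel hs, slotLaw_apply (measurable_relabel hs),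
    slotLaw_apply hs, Fin.sum_univ_castSucc]
  simp only [phantomProb, Fin.snoc_castSucc, Fin.snoc_last, ENNReal.ofReal_zero, zero_mul,
    zero_add, sub_zero, ENNReal.ofReal_one, one_mul, Set.mem_preimage, relabel, if_true,
    Bool.false_eq_true, if_false, mul_add, Finset.sum_add_distrib]
  rw [add_comm]
  congr 1
  · refine Finset.sum_congr rfl fun n _ => ?_
    rw [ENNReal.ofReal_mul (hη n), mul_assoc]
  · rw [phantomLaw, Measure.finsetSum_apply, Finset.mul_sum]
    refine Finset.sum_congr rfl fun n _ => ?_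
    rw [Measure.smul_apply, smul_eq_mul, ← mul_assoc, ← mul_assoc, ← ENNReal.ofReal_mul (hη n),
      ← ENNReal.ofReal_mul hw.le, mul_div_cancel₀ _ hw.ne']

end Phantom

/-! ### Drop probabilities and the expanded scheduler -/

section Expansion

variable {N : ℕ} {η p : Fin N → ℝ} {σ : Fin N → Measure ℝ} {Ω : Type*} [MeasurableSpace Ω]
  {P : Measure Ω} {X : ℕ → Ω → Slot N}

theorem phantomWeight_nonneg (hη : ∀ n, 0 ≤ η n) (hp : ∀ n, 0 ≤ p n) : 0 ≤ phantomWeight η p :=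
  Finset.sum_nonneg fun n _ => mul_nonneg (hη n) (hp n)

theorem IsPGAW.measure_received (hX : IsPGAW P η p σ X) (k : ℕ) (n : Fin N) :
    P {ω | (X k ω).1 = n ∧ (X k ω).2.2 = false} =
      ENNReal.ofReal (phantomProb η p n.castSucc) := by
  have : ∀ n, IsProbabilityMeasure (σ n) := fun n => (hX.service n).isProb
  have h := Measure.map_apply (μ := P) (hX.measurable k) (measurableSet_received n)
  rw [hX.law k, slotLaw_apply (measurableSet_received n)] at h
  refine h.symm.trans ?_
  rw [Finset.sum_eq_single n (fun m _ hm => by simp [hm]) (by simp)]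
  simp [phantomProb, ENNReal.ofReal_mul (hX.prob_nonneg n)]

/-- Serves twice: `s = univ` gives the drop probability, general `s` the conditional law of the
service time. -/
theorem IsPGAW.measure_dropped_inter (hX : IsPGAW P η p σ X) (k : ℕ) {s : Set ℝ}
    (hs : MeasurableSet s) :
    P ({ω | (X k ω).2.2 = true} ∩ (fun ω => (X k ω).2.1) ⁻¹' s) =
      ∑ n, ENNReal.ofReal (η n * p n) * σ n s := by
  have : ∀ n, IsProbabilityMeasure (σ n) := fun n => (hX.service n).isProb
  have hm : MeasurableSet ({y : Slot N | y.2.2 = true} ∩ (fun y => y.2.1) ⁻¹' s) :=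
    measurableSet_dropped.inter ((measurable_fst.comp measurable_snd) hs)
  have h := Measure.map_apply (μ := P) (hX.measurable k) hm
  rw [hX.law k, slotLaw_apply hm] at h
  refine h.symm.trans (Finset.sum_congr rfl fun n _ => ?_)
  rw [ENNReal.ofReal_mul (hX.prob_nonneg n), mul_assoc]
  simp

theorem IsPGAW.measure_dropped (hX : IsPGAW P η p σ X) (k : ℕ) :
    P {ω | (X k ω).2.2 = true} = ENNReal.ofReal (phantomProb η p (Fin.last N)) := by
  have h1 : ∀ n, σ n Set.univ = 1 := fun n => (hX.service n).isProb.measure_univ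
  have h := hX.measure_dropped_inter k MeasurableSet.univ
  simp only [Set.preimage_univ, Set.inter_univ, h1, mul_one] at h
  rw [h, phantomProb, Fin.snoc_last, phantomWeight, ENNReal.ofReal_sum_of_nonneg fun n _ =>
    mul_nonneg (hX.prob_nonneg n) (hX.drop_nonneg n)]

theorem IsPGAW.map_cond_dropped (hX : IsPGAW P η p σ X) (hw : 0 < phantomWeight η p) (k : ℕ) :
    (ProbabilityTheory.cond P {ω | (X k ω).2.2 = true}).map (fun ω => (X k ω).2.1) =
      phantomLaw η p σ := by
  have hS : Measurable fun ω => (X k ω).2.1 :=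
    measurable_fst.comp (measurable_snd.comp (hX.measurable k))
  have hD : MeasurableSet {ω | (X k ω).2.2 = true} := hX.measurable k measurableSet_dropped
  ext s hs
  rw [Measure.map_apply hS hs, cond_apply hD,
    hX.measure_dropped_inter k hs, hX.measure_dropped k, phantomProb, Fin.snoc_last, phantomLaw,
    Measure.finsetSum_apply, Finset.mul_sum]
  refine Finset.sum_congr rfl fun n _ => ?_
  rw [Measure.smul_apply, smul_eq_mul, ENNReal.ofReal_div_of_pos hw, div_eq_mul_inv]
  ring

theorem IsPGAW.expand (hX : IsPGAW P η p σ X) (hw : 0 < phantomWeight η p) :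
    IsPGAW P (phantomProb η p) (fun _ => 0)
      (Fin.snoc σ (phantomLaw η p σ) : Fin (N + 1) → Measure ℝ)
      (fun k ω => relabel (X k ω)) where
  prob_nonneg n := by
    refine Fin.lastCases ?_ (fun n => ?_) n
    · rw [phantomProb, Fin.snoc_last]; exact hw.le
    · rw [phantomProb, Fin.snoc_castSucc]
      exact mul_nonneg (hX.prob_nonneg n) (sub_nonneg.2 (hX.drop_le_one n))
  prob_sum := by
    rw [Fin.sum_univ_castSucc]
    simp only [phantomProb, Fin.snoc_castSucc, Fin.snoc_last, phantomWeight]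
    rw [← Finset.sum_add_distrib]
    exact (Finset.sum_congr rfl fun n _ => by ring).trans hX.prob_sum
  drop_nonneg _ := le_rfl
  drop_le_one _ := zero_le_one
  service n := by
    refine Fin.lastCases ?_ (fun n => ?_) n
    · rw [Fin.snoc_last]
      exact isServiceLaw_phantomLaw hX.prob_nonneg hX.drop_nonneg hX.service hw
    · rw [Fin.snoc_castSucc]; exact hX.service n
  measurable k := measurable_relabel.comp (hX.measurable k)
  indep := hX.indep.comp (fun _ => relabel) fun _ => measurable_relabel
  law k := by
    rw [← map_relabel_slotLaw hX.prob_nonneg hX.drop_nonneg hX.service hw, ← hX.law k,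
      Measure.map_map measurable_relabel (hX.measurable k)]
    rfl

end Expansion

/-! ### A strong law from second moments -/

section StrongLaw

variable {Ω : Type*} [MeasurableSpace Ω] {P : Measure Ω}

/-- By Tonelli the series `∑ Y n` is almost surely finite, so its terms tend to zero. -/
theorem ae_tendsto_zero_of_summable_integral {Y : ℕ → Ω → ℝ} (hY : ∀ n, Integrable (Y n) P)
    (h0 : ∀ n ω, 0 ≤ Y n ω) (hs : Summable fun n => ∫ ω, Y n ω ∂P) :
    ∀ᵐ ω ∂P, Tendsto (fun n => Y n ω) atTop (𝓝 0) := by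
  have hm : ∀ n, AEMeasurable (fun ω => ENNReal.ofReal (Y n ω)) P :=
    fun n => (hY n).aestronglyMeasurable.aemeasurable.ennreal_ofReal
  have hfin : ∫⁻ ω, ∑' n, ENNReal.ofReal (Y n ω) ∂P ≠ ∞ := by
    rw [lintegral_tsum hm]
    simp_rw [← fun n => ofReal_integral_eq_lintegral_ofReal (hY n) (ae_of_all _ (h0 n))]
    exact hs.tsum_ofReal_ne_top
  filter_upwards [ae_lt_top' (AEMeasurable.tsum hm) hfin] with ω hω
  have h1 := ENNReal.tendsto_atTop_zero_of_tsum_ne_top hω.ne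
  have h2 := (ENNReal.tendsto_toReal (by simp)).comp h1
  simpa [Function.comp_def, ENNReal.toReal_ofReal (h0 _ ω)] using h2

/-- At `n = 0` the bound reads `C / 0 = 0`; it is met in the applications because `Z 0` is itself a
quotient by zero. -/
theorem ae_tendsto_zero_of_integral_sq_le {Z : ℕ → Ω → ℝ} (hZ : ∀ n, MemLp (Z n) 2 P) {C : ℝ}
    (hC : ∀ n : ℕ, ∫ ω, Z n ω ^ 2 ∂P ≤ C / (n : ℝ) ^ 2) :
    ∀ᵐ ω ∂P, Tendsto (fun n => Z n ω) atTop (𝓝 0) := by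
  have hs : Summable fun n => ∫ ω, Z n ω ^ 2 ∂P := by
    refine Summable.of_nonneg_of_le (fun n => integral_nonneg fun ω => sq_nonneg _) hC ?_
    simpa [div_eq_mul_inv] using (Real.summable_nat_pow_inv.2 one_lt_two).mul_left C
  filter_upwards [ae_tendsto_zero_of_summable_integral (fun n => (hZ n).integrable_sq)
    (fun n ω => sq_nonneg _) hs] with ω hω
  have h := hω.sqrt
  simp only [Real.sqrt_sq_eq_abs, Real.sqrt_zero] at h
  exact (tendsto_zero_iff_abs_tendsto_zero _).2 h

theorem integral_sq_sum_range_le {U : ℕ → Ω → ℝ} (hU : ∀ k, MemLp (U k) 2 P)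
    (horth : ∀ j k, j < k → ∫ ω, U j ω * U k ω ∂P = 0) {C : ℝ}
    (hC : ∀ k, ∫ ω, U k ω ^ 2 ∂P ≤ C) (n : ℕ) :
    ∫ ω, (∑ k ∈ Finset.range n, U k ω) ^ 2 ∂P ≤ n * C := by
  induction n with
  | zero => simp
  | succ n ih =>
    have hS : MemLp (fun ω => ∑ k ∈ Finset.range n, U k ω) 2 P :=
      memLp_finsetSum _ fun k _ => hU k
    have hcross : ∫ ω, (∑ k ∈ Finset.range n, U k ω) * U n ω ∂P = 0 := by
      simp_rw [Finset.sum_mul]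
      rw [integral_finsetSum _ fun k _ => by exact (hU k).integrable_mul (hU n)]
      exact Finset.sum_eq_zero fun k hk => horth k n (Finset.mem_range.1 hk)
    have hexp : ∀ ω, (∑ k ∈ Finset.range (n + 1), U k ω) ^ 2 =
        (∑ k ∈ Finset.range n, U k ω) ^ 2 +
          2 * ((∑ k ∈ Finset.range n, U k ω) * U n ω) + U n ω ^ 2 := by
      intro ω; rw [Finset.sum_range_succ]; ring
    simp_rw [hexp]
    have hI : Integrable (fun ω => 2 * ((∑ k ∈ Finset.range n, U k ω) * U n ω)) P :=
      (hS.integrable_mul (hU n)).const_mul 2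
    rw [integral_add (by exact hS.integrable_sq.add hI) (hU n).integrable_sq,
      integral_add hS.integrable_sq hI, integral_const_mul, hcross]
    push_cast
    linarith [hC n]

theorem integral_sq_sum_abs_le {U : ℕ → Ω → ℝ} (hU : ∀ k, MemLp (U k) 2 P) {C : ℝ}
    (hC : ∀ k, ∫ ω, U k ω ^ 2 ∂P ≤ C) (s : Finset ℕ) :
    ∫ ω, (∑ k ∈ s, |U k ω|) ^ 2 ∂P ≤ (s.card : ℝ) ^ 2 * C := by
  have hS : MemLp (fun ω => ∑ k ∈ s, |U k ω|) 2 P := memLp_finsetSum _ fun k _ => (hU k).abs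
  calc ∫ ω, (∑ k ∈ s, |U k ω|) ^ 2 ∂P ≤ ∫ ω, s.card * ∑ k ∈ s, U k ω ^ 2 ∂P := by
        refine integral_mono hS.integrable_sq
          ((integrable_finsetSum _ fun k _ => (hU k).integrable_sq).const_mul _) fun ω => ?_
        simpa using sq_sum_le_card_mul_sum_sq (s := s) (f := fun k => |U k ω|)
    _ = s.card * ∑ k ∈ s, ∫ ω, U k ω ^ 2 ∂P := by
        rw [integral_const_mul, integral_finsetSum _ fun k _ => (hU k).integrable_sq]
    _ ≤ s.card * ∑ k ∈ s, C := by gcongr with k; exact hC k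
    _ = (s.card : ℝ) ^ 2 * C := by rw [Finset.sum_const, nsmul_eq_mul]; ring

/-- Strong law of large numbers for orthogonal random variables with bounded second moments. -/
theorem strong_law_of_orthogonal {U : ℕ → Ω → ℝ} (hU : ∀ k, MemLp (U k) 2 P)
    (horth : ∀ j k, j < k → ∫ ω, U j ω * U k ω ∂P = 0) {C : ℝ}
    (hC : ∀ k, ∫ ω, U k ω ^ 2 ∂P ≤ C) :
    ∀ᵐ ω ∂P, Tendsto (fun n : ℕ => (∑ k ∈ Finset.range n, U k ω) / n) atTop (𝓝 0) := by
  have hC0 : 0 ≤ C := (integral_nonneg fun ω => sq_nonneg (U 0 ω)).trans (hC 0)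
  -- Along the squares, orthogonality bounds the second moment of the average by `C / r ^ 2`, which
  -- is summable.
  have h1 := ae_tendsto_zero_of_integral_sq_le (P := P) (C := C)
    (Z := fun r ω => (∑ k ∈ Finset.range (r ^ 2), U k ω) * ((r : ℝ) ^ 2)⁻¹)
    (fun r => (memLp_finsetSum _ fun k _ => hU k).mul_const _) (fun r => by
      simp_rw [mul_pow]
      rw [integral_mul_const]
      rcases Nat.eq_zero_or_pos r with rfl | hr
      · simp
      have hr' : (0 : ℝ) < r := by exact_mod_cast hr
      calc _ ≤ ((r ^ 2 : ℕ) : ℝ) * C * (((r : ℝ) ^ 2)⁻¹) ^ 2 := by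
            gcongr; exact integral_sq_sum_range_le hU horth hC _
        _ = C / (r : ℝ) ^ 2 := by push_cast; field_simp)
  -- Between consecutive squares absolute values suffice: a block has `2 * r + 1 ≤ 3 * r` terms,
  -- whence the factor `9`.
  have h2 := ae_tendsto_zero_of_integral_sq_le (P := P) (C := 9 * C)
    (Z := fun r ω => (∑ k ∈ Finset.Ico (r ^ 2) ((r + 1) ^ 2), |U k ω|) * ((r : ℝ) ^ 2)⁻¹)
    (fun r => (memLp_finsetSum _ fun k _ => (hU k).abs).mul_const _) (fun r => by
      simp_rw [mul_pow]
      rw [integral_mul_const]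
      rcases Nat.eq_zero_or_pos r with rfl | hr
      · simp
      have hr' : (1 : ℝ) ≤ r := by exact_mod_cast hr
      have hcard : ((Finset.Ico (r ^ 2) ((r + 1) ^ 2)).card : ℝ) = 2 * r + 1 := by
        rw [Nat.card_Ico, show (r + 1) ^ 2 - r ^ 2 = 2 * r + 1 by
          rw [add_sq]; omega]
        push_cast; ring
      calc _ ≤ (2 * r + 1 : ℝ) ^ 2 * C * (((r : ℝ) ^ 2)⁻¹) ^ 2 := by
            rw [← hcard]; gcongr; exact integral_sq_sum_abs_le hU hC _
        _ ≤ (3 * r : ℝ) ^ 2 * C * (((r : ℝ) ^ 2)⁻¹) ^ 2 := by gcongr; linarith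
        _ = 9 * C / (r : ℝ) ^ 2 := by field_simp; ring)
  have hsqrt : Tendsto Nat.sqrt atTop atTop :=
    tendsto_atTop_mono' _ (f₁ := Nat.sqrt) (by rfl)
      (tendsto_atTop.2 fun b => (eventually_ge_atTop (b ^ 2)).mono fun n hn =>
        Nat.le_sqrt'.2 hn)
  filter_upwards [h1, h2] with ω hω1 hω2
  have hlim := (hω1.abs.add hω2).comp hsqrt
  simp only [abs_zero, add_zero] at hlim
  refine squeeze_zero_norm' ?_ hlim
  filter_upwards [eventually_ge_atTop 1] with n hn
  set r := n.sqrt with hr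
  have hrn : r ^ 2 ≤ n := Nat.sqrt_le' n
  have hnr : n < (r + 1) ^ 2 := Nat.lt_succ_sqrt' n
  have hrpos : 0 < r := Nat.sqrt_pos.2 hn
  have hrpos' : (0 : ℝ) < (r : ℝ) ^ 2 := by positivity
  have hsum : |∑ k ∈ Finset.range n, U k ω| ≤ |∑ k ∈ Finset.range (r ^ 2), U k ω| +
      ∑ k ∈ Finset.Ico (r ^ 2) ((r + 1) ^ 2), |U k ω| := by
    rw [← Finset.sum_range_add_sum_Ico _ hrn]
    refine (abs_add_le _ _).trans (add_le_add_right ?_ _)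
    refine (Finset.abs_sum_le_sum_abs _ _).trans ?_
    exact Finset.sum_le_sum_of_subset_of_nonneg
      (Finset.Ico_subset_Ico_right hnr.le) fun _ _ _ => abs_nonneg _
  simp only [Function.comp_apply, ← hr]
  rw [Real.norm_eq_abs, abs_div, abs_mul, abs_of_pos (inv_pos.2 hrpos'), ← add_mul,
    ← div_eq_mul_inv, Nat.abs_cast]
  have : ((r : ℝ) ^ 2) ≤ n := by exact_mod_cast hrn
  gcongr

end StrongLaw

/-! ### Deterministic analysis of a sample path -/

section Path

variable {N : ℕ}

/-- The age of source `n` at the start of the `k`-th scheduling instance, with initial age `a`. -/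
def ageAtStart (x : ℕ → Slot N) (a : ℝ) (n : Fin N) : ℕ → ℝ
  | 0 => a
  | k + 1 => (if (x k).1 = n ∧ (x k).2.2 = false then 0 else ageAtStart x a n k) + (x k).2.1

theorem slotStart_zero (x : ℕ → Slot N) : slotStart x 0 = 0 := by simp [slotStart]

theorem slotStart_succ (x : ℕ → Slot N) (k : ℕ) :
    slotStart x (k + 1) = slotStart x k + (x k).2.1 := Finset.sum_range_succ _ _

theorem slotStart_mono {x : ℕ → Slot N} (hx : ∀ k, 0 ≤ (x k).2.1) : Monotone (slotStart x) :=
  monotone_nat_of_le_succ fun k => by rw [slotStart_succ]; linarith [hx k]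

theorem slotStart_nonneg {x : ℕ → Slot N} (hx : ∀ k, 0 ≤ (x k).2.1) (k : ℕ) :
    0 ≤ slotStart x k := Finset.sum_nonneg fun j _ => hx j

theorem ageAtStart_nonneg {x : ℕ → Slot N} (hx : ∀ k, 0 ≤ (x k).2.1) {a : ℝ} (ha : 0 ≤ a)
    (n : Fin N) (k : ℕ) : 0 ≤ ageAtStart x a n k := by
  induction k with
  | zero => exact ha
  | succ k ih =>
    rw [ageAtStart]
    split_ifs
    · simpa using hx k
    · exact add_nonneg ih (hx k)

theorem isGreatest_received {x : ℕ → Slot N} (hx : ∀ k, 0 ≤ (x k).2.1) {a : ℝ} (ha : 0 ≤ a)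
    (n : Fin N) (k : ℕ) :
    IsGreatest (insert (-a) {g : ℝ | ∃ j, (x j).1 = n ∧ (x j).2.2 = false ∧ j < k ∧
      g = slotStart x j}) (slotStart x k - ageAtStart x a n k) := by
  induction k with
  | zero => simp [ageAtStart, slotStart_zero]
  | succ k ih =>
    have hmono := slotStart_mono hx
    have h0 := slotStart_nonneg hx k
    rw [ageAtStart, slotStart_succ]
    split_ifs with hk
    · rw [zero_add, add_sub_cancel_right]
      refine ⟨Or.inr ⟨k, hk.1, hk.2, k.lt_succ_self, rfl⟩, ?_⟩
      rintro g (rfl | ⟨j, -, -, hj, rfl⟩)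
      · linarith
      · exact hmono (Nat.lt_succ_iff.1 hj)
    -- Without a reception, start time and age grow by the same service time and the set of
    -- generation times is unchanged.
    · rw [add_sub_add_right_eq_sub]
      convert ih using 3 with g
      ext g
      refine exists_congr fun j => and_congr_right fun h1 => and_congr_right fun h2 => ?_
      rw [Nat.lt_succ_iff_lt_or_eq]
      constructor
      · rintro ⟨h | rfl, h3⟩
        · exact ⟨h, h3⟩
        · exact absurd ⟨h1, h2⟩ hk
      · exact fun h => ⟨Or.inl h.1, h.2⟩

theorem age_eq_of_mem_Ico {x : ℕ → Slot N} (hx : ∀ k, 0 ≤ (x k).2.1) (a₀ : Fin N → ℝ≥0)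
    (n : Fin N) {k : ℕ} {t : ℝ} (ht : t ∈ Set.Ico (slotStart x k) (slotStart x (k + 1))) :
    age x a₀ n t = t - slotStart x k + ageAtStart x (a₀ n) n k := by
  have hset : {g : ℝ | ∃ j, (x j).1 = n ∧ (x j).2.2 = false ∧ slotStart x (j + 1) ≤ t ∧
      g = slotStart x j} = {g : ℝ | ∃ j, (x j).1 = n ∧ (x j).2.2 = false ∧ j < k ∧
      g = slotStart x j} := by
    ext g
    refine exists_congr fun j => and_congr_right fun _ => and_congr_right fun _ =>
      and_congr_left fun _ => ⟨fun h => ?_, fun h => ?_⟩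
    · by_contra hjk
      have := slotStart_mono hx (show k + 1 ≤ j + 1 by omega)
      linarith [ht.2]
    · exact (slotStart_mono hx (Nat.succ_le_of_lt h)).trans ht.1
  have hmax := (isGreatest_received hx (a₀ n).coe_nonneg n k).csSup_eq
  rw [age, freshestGen, hset, hmax]
  ring

/-- The linear formula may fail at the right end of the slot, where a packet can arrive; that single
point is null. -/
theorem age_ae_eq_slot {x : ℕ → Slot N} (hx : ∀ k, 0 ≤ (x k).2.1) (a₀ : Fin N → ℝ≥0)
    (n : Fin N) (k : ℕ) :
    (fun t => t - slotStart x k + ageAtStart x (a₀ n) n k) =ᵐ[volume.restrict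
      (Set.uIoc (slotStart x k) (slotStart x (k + 1)))] age x a₀ n := by
  rw [Set.uIoc_of_le (slotStart_mono hx k.le_succ), ← restrict_Ico_eq_restrict_Ioc]
  filter_upwards [ae_restrict_mem measurableSet_Ico] with t ht
  exact (age_eq_of_mem_Ico hx a₀ n ht).symm

theorem intervalIntegrable_age_slot {x : ℕ → Slot N} (hx : ∀ k, 0 ≤ (x k).2.1)
    (a₀ : Fin N → ℝ≥0) (n : Fin N) (k : ℕ) :
    IntervalIntegrable (age x a₀ n) volume (slotStart x k) (slotStart x (k + 1)) :=
  (Continuous.intervalIntegrable (by fun_prop) _ _).congr_ae (age_ae_eq_slot hx a₀ n k)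

theorem integral_age_slot {x : ℕ → Slot N} (hx : ∀ k, 0 ≤ (x k).2.1)
    (a₀ : Fin N → ℝ≥0) (n : Fin N) (k : ℕ) :
    ∫ t in slotStart x k..slotStart x (k + 1), age x a₀ n t =
      ageAtStart x (a₀ n) n k * (x k).2.1 + (x k).2.1 ^ 2 / 2 := by
  rw [← intervalIntegral.integral_congr_ae_restrict (age_ae_eq_slot hx a₀ n k),
    intervalIntegral.integral_add (Continuous.intervalIntegrable (by fun_prop) _ _)
      (Continuous.intervalIntegrable (by fun_prop) _ _),
    intervalIntegral.integral_comp_sub_right (fun t => t), integral_id,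
    intervalIntegral.integral_const, slotStart_succ, smul_eq_mul]
  ring

theorem exists_mem_Ico_slotStart {x : ℕ → Slot N}
    (hT : Tendsto (slotStart x) atTop atTop) {t : ℝ} (ht : 0 ≤ t) :
    ∃ k, t ∈ Set.Ico (slotStart x k) (slotStart x (k + 1)) := by
  classical
  have hex : ∃ k, t < slotStart x k := (hT.eventually_gt_atTop t).exists
  have hpos : Nat.find hex ≠ 0 := fun h => by
    have := Nat.find_spec hex
    rw [h, slotStart_zero] at this
    linarith
  obtain ⟨k, hk⟩ := Nat.exists_eq_succ_of_ne_zero hpos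
  exact ⟨k, not_lt.1 (Nat.find_min hex (by omega)), by
    have := Nat.find_spec hex
    rwa [hk] at this⟩

theorem age_nonneg {x : ℕ → Slot N} (hx : ∀ k, 0 ≤ (x k).2.1)
    (hT : Tendsto (slotStart x) atTop atTop) (a₀ : Fin N → ℝ≥0) (n : Fin N) {t : ℝ}
    (ht : 0 ≤ t) : 0 ≤ age x a₀ n t := by
  obtain ⟨k, hk⟩ := exists_mem_Ico_slotStart hT ht
  rw [age_eq_of_mem_Ico hx a₀ n hk]
  exact add_nonneg (sub_nonneg.2 hk.1) (ageAtStart_nonneg hx (a₀ n).coe_nonneg n k)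

theorem intervalIntegrable_age_slotStart {x : ℕ → Slot N} (hx : ∀ k, 0 ≤ (x k).2.1)
    (a₀ : Fin N → ℝ≥0) (n : Fin N) (k : ℕ) :
    IntervalIntegrable (age x a₀ n) volume 0 (slotStart x k) := by
  rw [← slotStart_zero x]
  exact IntervalIntegrable.trans_iterate fun j _ => intervalIntegrable_age_slot hx a₀ n j

theorem integral_age_slotStart {x : ℕ → Slot N} (hx : ∀ k, 0 ≤ (x k).2.1)
    (a₀ : Fin N → ℝ≥0) (n : Fin N) (k : ℕ) :
    ∫ t in (0 : ℝ)..slotStart x k, age x a₀ n t = ∑ j ∈ Finset.range k,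
      (ageAtStart x (a₀ n) n j * (x j).2.1 + (x j).2.1 ^ 2 / 2) := by
  rw [← slotStart_zero x, ← intervalIntegral.sum_integral_adjacent_intervals fun j _ =>
    intervalIntegrable_age_slot hx a₀ n j]
  exact Finset.sum_congr rfl fun j _ => integral_age_slot hx a₀ n j

theorem tendsto_slotStart_atTop {x : ℕ → Slot N} {m : ℝ} (hm : 0 < m)
    (hT : Tendsto (fun k : ℕ => slotStart x k / k) atTop (𝓝 m)) :
    Tendsto (slotStart x) atTop atTop := by
  refine Tendsto.congr' ?_ (hT.pos_mul_atTop hm tendsto_natCast_atTop_atTop)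
  filter_upwards [eventually_ne_atTop 0] with k hk
  exact div_mul_cancel₀ _ (Nat.cast_ne_zero.2 hk)

/-- The time average of the age, from the averages over the scheduling instances. -/
theorem isTimeAverage_age {x : ℕ → Slot N} (hx : ∀ k, 0 ≤ (x k).2.1) (a₀ : Fin N → ℝ≥0)
    (n : Fin N) {m c : ℝ} (hm : 0 < m)
    (hT : Tendsto (fun k : ℕ => slotStart x k / k) atTop (𝓝 m))
    (hA : Tendsto (fun k : ℕ => (∑ j ∈ Finset.range k,
      (ageAtStart x (a₀ n) n j * (x j).2.1 + (x j).2.1 ^ 2 / 2)) / (k : ℝ)) atTop (𝓝 c)) :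
    IsTimeAverage (age x a₀ n) (c / m) := by
  have hTop := tendsto_slotStart_atTop hm hT
  have hint : ∀ T, 0 ≤ T → IntervalIntegrable (age x a₀ n) volume 0 T := fun T hT0 => by
    obtain ⟨k, hk⟩ := (hTop.eventually_ge_atTop T).exists
    exact (intervalIntegrable_age_slotStart hx a₀ n k).mono_set (by
      rw [Set.uIcc_of_le hT0, Set.uIcc_of_le (hT0.trans hk)]
      exact Set.Icc_subset_Icc_right hk)
  refine ⟨hint, ?_⟩
  -- `κ T` will be the slot in progress at time `T`; the implication lets it be chosen for every
  -- real `T`.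
  have hex : ∀ T : ℝ, ∃ k, 0 ≤ T → T ∈ Set.Ico (slotStart x k) (slotStart x (k + 1)) := fun T => by
    by_cases hT0 : 0 ≤ T
    · exact (exists_mem_Ico_slotStart hTop hT0).imp fun k hk _ => hk
    · exact ⟨0, fun h => absurd h hT0⟩
  choose κ hκ using hex
  have hκTop : Tendsto κ atTop atTop := by
    refine tendsto_atTop.2 fun b => ?_
    filter_upwards [eventually_ge_atTop (slotStart x b), eventually_ge_atTop 0] with T hTb hT0
    by_contra! hlt
    have := slotStart_mono hx (Nat.succ_le_of_lt hlt)
    linarith [(hκ T hT0).2]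
  set G : ℕ → ℝ := fun k => ∫ t in (0 : ℝ)..slotStart x k, age x a₀ n t with hG
  have hGlim : Tendsto (fun k : ℕ => G k / k) atTop (𝓝 c) := by
    simpa only [hG, integral_age_slotStart hx] using hA
  have hmonoI : ∀ {s t : ℝ}, 0 ≤ s → s ≤ t →
      ∫ u in (0 : ℝ)..s, age x a₀ n u ≤ ∫ u in (0 : ℝ)..t, age x a₀ n u := fun {s t} hs hst => by
    refine intervalIntegral.integral_mono_interval le_rfl hs hst ?_ (hint t (hs.trans hst))
    filter_upwards [ae_restrict_mem measurableSet_Ioc] with u hu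
    exact age_nonneg hx hTop a₀ n hu.1.le
  have hshift : Tendsto (fun k : ℕ => ((k : ℝ) + 1) / k) atTop (𝓝 1) := by
    have h := (tendsto_const_nhds (x := (1 : ℝ))).add
      (tendsto_inv_atTop_nhds_zero_nat (𝕜 := ℝ))
    rw [add_zero] at h
    refine h.congr' ?_
    filter_upwards [eventually_ne_atTop 0] with k hk
    field_simp
  have hshift' : Tendsto (fun k : ℕ => (k : ℝ) / (k + 1)) atTop (𝓝 1) := by
    simpa using hshift.inv₀ one_ne_zero
  have hT' : Tendsto (fun k : ℕ => slotStart x (k + 1) / ((k : ℝ) + 1)) atTop (𝓝 m) := by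
    simpa [Function.comp_def] using hT.comp (tendsto_add_atTop_nat 1)
  have hG' : Tendsto (fun k : ℕ => G (k + 1) / ((k : ℝ) + 1)) atTop (𝓝 c) := by
    simpa [Function.comp_def] using hGlim.comp (tendsto_add_atTop_nat 1)
  have hlow : Tendsto (fun k => G k / slotStart x (k + 1)) atTop (𝓝 (c / m)) := by
    have h := (hGlim.div hT' hm.ne').mul hshift'
    rw [mul_one] at h
    refine h.congr' ?_
    filter_upwards [eventually_ne_atTop 0] with k hk
    simp only [Pi.div_apply]
    have : (k : ℝ) ≠ 0 := Nat.cast_ne_zero.2 hk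
    have : (k : ℝ) + 1 ≠ 0 := by positivity
    field_simp
  have hupp : Tendsto (fun k => G (k + 1) / slotStart x k) atTop (𝓝 (c / m)) := by
    have h := (hG'.div hT hm.ne').mul hshift
    rw [mul_one] at h
    refine h.congr' ?_
    filter_upwards [eventually_ne_atTop 0] with k hk
    simp only [Pi.div_apply]
    have : (k : ℝ) ≠ 0 := Nat.cast_ne_zero.2 hk
    have : (k : ℝ) + 1 ≠ 0 := by positivity
    field_simp
  -- As the age is nonnegative, its integral up to `T` lies between those up to the two ends of slot
  -- `κ T`; dividing by the opposite ends sandwiches the average.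
  refine tendsto_of_tendsto_of_tendsto_of_le_of_le' (hlow.comp hκTop) (hupp.comp hκTop) ?_ ?_
  · filter_upwards [eventually_gt_atTop 0] with T hT0
    obtain ⟨h1, h2⟩ := hκ T hT0.le
    have h0 := slotStart_nonneg hx (κ T)
    have hI : 0 ≤ G (κ T) := by
      have := hmonoI le_rfl h0
      rwa [intervalIntegral.integral_same] at this
    exact div_le_div₀ (hI.trans (hmonoI h0 h1)) (hmonoI h0 h1) hT0 h2.le
  · filter_upwards [eventually_gt_atTop 0, (hTop.comp hκTop).eventually_gt_atTop 0] with T hT0 hpos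
    obtain ⟨h1, h2⟩ := hκ T hT0.le
    have hI : 0 ≤ G (κ T + 1) := by
      have := hmonoI le_rfl (slotStart_nonneg hx (κ T + 1))
      rwa [intervalIntegral.integral_same] at this
    exact div_le_div₀ hI (hmonoI hT0.le h2.le) hpos h1

theorem isTimeAverage_sum {ι : Type*} (s : Finset ι) {f : ι → ℝ → ℝ} {a : ι → ℝ} (w : ι → ℝ)
    (h : ∀ i ∈ s, IsTimeAverage (f i) (a i)) :
    IsTimeAverage (fun t => ∑ i ∈ s, w i * f i t) (∑ i ∈ s, w i * a i) := by
  refine ⟨fun T hT => ?_, ?_⟩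
  · have := IntervalIntegrable.sum (μ := volume) (a := 0) (b := T) s
      (f := fun i t => w i * f i t) fun i hi => ((h i hi).1 T hT).const_mul (w i)
    simpa [Finset.sum_fn] using this
  · refine (tendsto_finsetSum s fun i hi => (h i hi).2.const_mul (w i)).congr' ?_
    filter_upwards [eventually_ge_atTop 0] with T hT
    rw [intervalIntegral.integral_finsetSum fun i hi => ((h i hi).1 T hT).const_mul (w i),
      Finset.sum_div]
    refine Finset.sum_congr rfl fun i _ => ?_
    rw [intervalIntegral.integral_const_mul, mul_div_assoc]

end Path

/-! ### The age chain: independence of the past and slot averages -/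

section MeanAge

variable {N : ℕ} {η p : Fin N → ℝ} {σ : Fin N → Measure ℝ} {Ω : Type*} [MeasurableSpace Ω]
  {P : Measure Ω} {X : ℕ → Ω → Slot N}

/-- The indicator of the reception of a packet of source `n`. -/
def received (n : Fin N) (y : Slot N) : ℝ := if y.1 = n ∧ y.2.2 = false then 1 else 0

/-- The mean service time of a scheduling instance. -/
def slotMean (η : Fin N → ℝ) (σ : Fin N → Measure ℝ) : ℝ := ∑ n, η n * mean (σ n)

/-- The second moment of the service time of a scheduling instance. -/
def slotSecondMoment (η : Fin N → ℝ) (σ : Fin N → Measure ℝ) : ℝ :=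
  ∑ n, η n * secondMoment (σ n)

theorem measurable_received (n : Fin N) : Measurable (received n) :=
  Measurable.ite (measurableSet_received n) measurable_const measurable_const

theorem ageAtStart_succ (x : ℕ → Slot N) (a : ℝ) (n : Fin N) (k : ℕ) :
    ageAtStart x a n (k + 1) = (1 - received n (x k)) * ageAtStart x a n k + (x k).2.1 := by
  rw [ageAtStart, received]
  split_ifs <;> ring

theorem measurable_ageAtStart (a : ℝ) (n : Fin N) (k : ℕ) :
    Measurable fun x : ℕ → Slot N => ageAtStart x a n k := by
  induction k with
  | zero => exact measurable_const
  | succ k ih =>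
    simp_rw [ageAtStart_succ]
    exact ((((measurable_received n).comp (measurable_pi_apply k)).const_sub 1).mul ih).add
      (measurable_fst.comp (measurable_snd.comp (measurable_pi_apply k)))

theorem ageAtStart_congr {x y : ℕ → Slot N} (a : ℝ) (n : Fin N) {k : ℕ}
    (h : ∀ j < k, x j = y j) : ageAtStart x a n k = ageAtStart y a n k := by
  induction k with
  | zero => rfl
  | succ k ih =>
    rw [ageAtStart_succ, ageAtStart_succ, ih fun j hj => h j (hj.trans k.lt_succ_self),
      h k k.lt_succ_self]

theorem IsPGAW.measurable_path (hX : IsPGAW P η p σ X) : Measurable fun ω k => X k ω :=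
  measurable_pi_iff.2 hX.measurable

/-- What is determined by the first `k` scheduling instances is independent of the next one. -/
theorem IsPGAW.indepFun_past (hX : IsPGAW P η p σ X) {β : Type*} [MeasurableSpace β] {k : ℕ}
    {F : (ℕ → Slot N) → β} (hF : Measurable F)
    (hdep : ∀ x y : ℕ → Slot N, (∀ j < k, x j = y j) → F x = F y) :
    IndepFun (fun ω => F fun j => X j ω) (X k) P := by
  have := hX.indep.isProbabilityMeasure
  obtain ⟨ω₀⟩ := nonempty_of_isProbabilityMeasure P
  -- A finite history is extended to a full path by an arbitrary slot, which `F` does not see; `X 0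
  -- ω₀` supplies one even though `Slot N` may be empty for `N = 0`.
  let E : ((Finset.range k) → Slot N) → ℕ → Slot N := fun z j =>
    if h : j ∈ Finset.range k then z ⟨j, h⟩ else X 0 ω₀
  have hE : Measurable E := measurable_pi_iff.2 fun j => by
    by_cases h : j ∈ Finset.range k
    · simpa only [E, h, dif_pos] using measurable_pi_apply (⟨j, h⟩ : Finset.range k)
    · simpa only [E, h, dif_neg, not_false_iff] using measurable_const
  have h := (hX.indep.indepFun_finset (Finset.range k) {k} (by simp) hX.measurable).comp
    (hF.comp hE) (measurable_pi_apply (⟨k, by simp⟩ : ({k} : Finset ℕ)))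
  refine h.congr (ae_of_all _ fun ω => hdep _ _ fun j hj => ?_) (ae_of_all _ fun ω => rfl)
  simp [E, hj]

theorem IsPGAW.integrable_comp (hX : IsPGAW P η p σ X) (k : ℕ) {f : Slot N → ℝ}
    (hf : Measurable f) (hi : ∀ n b, Integrable (fun x => f (n, x, b)) (σ n)) :
    Integrable (fun ω => f (X k ω)) P := by
  have : ∀ n, IsProbabilityMeasure (σ n) := fun n => (hX.service n).isProb
  have h := integrable_slotLaw (η := η) (p := p) hf hi
  rw [← hX.law k] at h
  exact h.comp_measurable (hX.measurable k)

theorem IsPGAW.integral_comp (hX : IsPGAW P η p σ X) (k : ℕ) {f : Slot N → ℝ}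
    (hf : Measurable f) (hi : ∀ n b, Integrable (fun x => f (n, x, b)) (σ n)) :
    ∫ ω, f (X k ω) ∂P = ∑ n, η n *
      (p n * ∫ x, f (n, x, true) ∂(σ n) + (1 - p n) * ∫ x, f (n, x, false) ∂(σ n)) := by
  have : ∀ n, IsProbabilityMeasure (σ n) := fun n => (hX.service n).isProb
  rw [← integral_slotLaw hX.prob_nonneg hX.drop_nonneg hX.drop_le_one hf hi, ← hX.law k,
    integral_map (hX.measurable k).aemeasurable hf.aestronglyMeasurable]

theorem measurable_service : Measurable fun y : Slot N => y.2.1 :=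
  measurable_fst.comp measurable_snd

theorem IsPGAW.integrable_service (hX : IsPGAW P η p σ X) (k : ℕ) :
    Integrable (fun ω => (X k ω).2.1) P :=
  hX.integrable_comp k measurable_service fun n _ => (hX.service n).integrable_id

theorem IsPGAW.memLp_service (hX : IsPGAW P η p σ X) (k : ℕ) :
    MemLp (fun ω => (X k ω).2.1) 2 P :=
  (memLp_two_iff_integrable_sq
    (measurable_service.comp (hX.measurable k)).aestronglyMeasurable).2
    (hX.integrable_comp k (measurable_service.pow_const 2) fun n _ => (hX.service n).integrable_sq)

theorem IsPGAW.integral_service (hX : IsPGAW P η p σ X) (k : ℕ) :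
    ∫ ω, (X k ω).2.1 ∂P = slotMean η σ := by
  rw [hX.integral_comp k measurable_service fun n _ => (hX.service n).integrable_id]
  exact Finset.sum_congr rfl fun n _ => by simp only [mean]; ring

theorem IsPGAW.integral_service_sq (hX : IsPGAW P η p σ X) (k : ℕ) :
    ∫ ω, (X k ω).2.1 ^ 2 ∂P = slotSecondMoment η σ := by
  rw [hX.integral_comp k (measurable_service.pow_const 2) fun n _ => (hX.service n).integrable_sq]
  exact Finset.sum_congr rfl fun n _ => by simp only [secondMoment]; ring

theorem IsPGAW.integrable_received_slot (hX : IsPGAW P η p σ X) (n m : Fin N) (b : Bool) :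
    Integrable (fun x => received n (m, x, b)) (σ m) :=
  have := (hX.service m).isProb
  integrable_const (μ := σ m) (if m = n ∧ b = false then (1 : ℝ) else 0)

theorem IsPGAW.integral_received (hX : IsPGAW P η p σ X) (k : ℕ) (n : Fin N) :
    ∫ ω, received n (X k ω) ∂P = η n * (1 - p n) := by
  have : ∀ n, IsProbabilityMeasure (σ n) := fun n => (hX.service n).isProb
  rw [hX.integral_comp k (measurable_received n) (hX.integrable_received_slot n), Finset.sum_eq_single n (fun m _ hm => by simp [received, hm]) (by simp)]
  simp [received]

theorem IsPGAW.slotMean_pos (hX : IsPGAW P η p σ X) : 0 < slotMean η σ := by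
  obtain ⟨n, -, hn⟩ := Finset.exists_lt_of_sum_lt (s := Finset.univ) (f := fun _ : Fin N => (0 : ℝ))
    (g := η) (by rw [hX.prob_sum]; simp)
  exact Finset.sum_pos' (fun m _ => mul_nonneg (hX.prob_nonneg m) (hX.service m).mean_pos.le)
    ⟨n, Finset.mem_univ n, mul_pos hn (hX.service n).mean_pos⟩

theorem IsPGAW.ae_service_nonneg (hX : IsPGAW P η p σ X) : ∀ᵐ ω ∂P, ∀ k, 0 ≤ (X k ω).2.1 := by
  have : ∀ n, IsProbabilityMeasure (σ n) := fun n => (hX.service n).isProb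
  refine ae_all_iff.2 fun k => ?_
  have hs : MeasurableSet {y : Slot N | ¬ 0 ≤ y.2.1} :=
    (measurable_service measurableSet_Ici).compl
  have h := Measure.map_apply (μ := P) (hX.measurable k) hs
  rw [hX.law k, slotLaw_apply hs] at h
  refine ae_iff.2 (h.symm.trans (Finset.sum_eq_zero fun n _ => ?_))
  have h0 := ae_iff.1 (hX.service n).nonneg
  simp only [Set.mem_ofPred_eq, h0, mul_zero, add_zero]

theorem IsPGAW.tendsto_average_comp (hX : IsPGAW P η p σ X) {f : Slot N → ℝ}
    (hf : Measurable f) (hi : Integrable (fun ω => f (X 0 ω)) P) :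
    ∀ᵐ ω ∂P, Tendsto (fun k : ℕ => (∑ j ∈ Finset.range k, f (X j ω)) / k) atTop
      (𝓝 (∫ ω, f (X 0 ω) ∂P)) :=
  strong_law_ae_real (fun j ω => f (X j ω)) hi
    (fun _ _ hij => (hX.indep.indepFun hij).comp hf hf) fun i =>
      (IdentDistrib.mk (hX.measurable i).aemeasurable (hX.measurable 0).aemeasurable
        ((hX.law i).trans (hX.law 0).symm)).comp hf

theorem IsPGAW.indepFun_ageAtStart (hX : IsPGAW P η p σ X) (a : ℝ) (n : Fin N) (k : ℕ) :
    IndepFun (fun ω => ageAtStart (fun j => X j ω) a n k) (X k) P :=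
  hX.indepFun_past (measurable_ageAtStart a n k) fun _ _ h => ageAtStart_congr a n h

theorem IsPGAW.measurable_ageAtStart_path (hX : IsPGAW P η p σ X) (a : ℝ) (n : Fin N) (k : ℕ) :
    Measurable fun ω => ageAtStart (fun j => X j ω) a n k :=
  (measurable_ageAtStart a n k).comp hX.measurable_path

theorem hasWeightedAoI_of_hasMeanAoI {a₀ : Fin N → ℝ≥0} {a : Fin N → ℝ} (w : Fin N → ℝ)
    (h : ∀ n, HasMeanAoI P X a₀ n (a n)) : HasWeightedAoI P X a₀ w (∑ n, w n * a n) := by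
  filter_upwards [ae_all_iff.2 h] with ω hω
  exact isTimeAverage_sum Finset.univ w fun n _ => hω n

/-- With weight `0` the phantom's term vanishes pointwise, so nothing is needed about its age, even
if it is never selected. -/
theorem hasWeightedAoI_snoc_zero {Y : ℕ → Ω → Slot (N + 1)} {b₀ : Fin (N + 1) → ℝ≥0}
    {a : Fin N → ℝ} (w : Fin N → ℝ) (h : ∀ n : Fin N, HasMeanAoI P Y b₀ n.castSucc (a n)) :
    HasWeightedAoI P Y b₀ (Fin.snoc w 0 : Fin (N + 1) → ℝ) (∑ n, w n * a n) := by
  filter_upwards [ae_all_iff.2 h] with ω hω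
  simp only [Fin.sum_univ_castSucc, Fin.snoc_castSucc, Fin.snoc_last, zero_mul, add_zero]
  exact isTimeAverage_sum Finset.univ w fun n _ => hω n

/-- Splitting the dropped transmissions off preserves sums weighted by the selection
probabilities. -/
theorem sum_phantomProb_mul (hη : ∀ n, 0 ≤ η n) (hp : ∀ n, 0 ≤ p n) {f : Fin N → ℝ}
    {g : Fin (N + 1) → ℝ} (hg : ∀ n : Fin N, g n.castSucc = f n)
    (hlast : 0 < phantomWeight η p →
      g (Fin.last N) = 1 / phantomWeight η p * ∑ n, η n * p n * f n) :
    ∑ n, phantomProb η p n * g n = ∑ n, η n * f n := by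
  have hsplit : phantomWeight η p * g (Fin.last N) = ∑ n, η n * p n * f n := by
    -- If no drops occur, every `η n * p n` is zero and the value of `g` at the phantom is
    -- irrelevant.
    rcases (phantomWeight_nonneg hη hp).eq_or_lt with h0 | hw
    · have hz := (Finset.sum_eq_zero_iff_of_nonneg fun n _ => mul_nonneg (hη n) (hp n)).1 h0.symm
      rw [← h0, zero_mul]
      exact (Finset.sum_eq_zero fun n hn => by rw [hz n hn, zero_mul]).symm
    · rw [hlast hw]
      field_simp
  rw [Fin.sum_univ_castSucc]
  simp only [phantomProb, Fin.snoc_castSucc, Fin.snoc_last, hg]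
  rw [hsplit, ← Finset.sum_add_distrib]
  exact Finset.sum_congr rfl fun n _ => by ring

/-! ### Second moments of the age chain and the mean age formula -/

variable [IsProbabilityMeasure P]

theorem IsPGAW.memLp_ageAtStart (hX : IsPGAW P η p σ X) (a : ℝ) (n : Fin N) (k : ℕ) :
    MemLp (fun ω => ageAtStart (fun j => X j ω) a n k) 2 P := by
  induction k with
  | zero => exact memLp_const a
  | succ k ih =>
    simp_rw [ageAtStart_succ]
    refine MemLp.add (ih.of_le ?_ (ae_of_all _ fun ω => ?_)) (hX.memLp_service k)
    · exact ((((measurable_received n).comp (hX.measurable k)).const_sub 1).mul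
        (hX.measurable_ageAtStart_path a n k)).aestronglyMeasurable
    · simp only [received]
      split_ifs <;> simp

/-- A contraction: reception contributes the factor `1 - α` by independence, and Young's inequality
with parameter `α` costs only `1 + α`. -/
theorem IsPGAW.integral_ageAtStart_sq_succ_le (hX : IsPGAW P η p σ X) (a : ℝ) {n : Fin N}
    (hα : 0 < η n * (1 - p n)) (k : ℕ) :
    ∫ ω, ageAtStart (fun j => X j ω) a n (k + 1) ^ 2 ∂P ≤
      (1 - (η n * (1 - p n)) ^ 2) * ∫ ω, ageAtStart (fun j => X j ω) a n k ^ 2 ∂P +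
        (1 + 1 / (η n * (1 - p n))) * slotSecondMoment η σ := by
  set α := η n * (1 - p n) with hαdef
  have hA := hX.memLp_ageAtStart a n k
  have hr : Measurable fun y : Slot N => 1 - received n y := (measurable_received n).const_sub 1
  have hri : Integrable (fun ω => received n (X k ω)) P :=
    hX.integrable_comp k (measurable_received n) (hX.integrable_received_slot n)
  have hind := hX.indepFun_ageAtStart a n k
  have hI : Integrable (fun ω => ageAtStart (fun j => X j ω) a n k ^ 2 *
      (1 - received n (X k ω))) P :=
    IndepFun.integrable_mul (hind.comp (measurable_id.pow_const 2) hr) hA.integrable_sq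
      ((integrable_const 1).sub hri)
  have hE : ∫ ω, ageAtStart (fun j => X j ω) a n k ^ 2 * (1 - received n (X k ω)) ∂P =
      (∫ ω, ageAtStart (fun j => X j ω) a n k ^ 2 ∂P) * (1 - α) := by
    rw [hind.integral_fun_comp_mul_comp (f := fun u => u ^ 2) (g := fun y => 1 - received n y)
      (hX.measurable_ageAtStart_path a n k).aemeasurable (hX.measurable k).aemeasurable
      (by fun_prop) hr.aestronglyMeasurable, integral_sub (integrable_const 1) hri,
      hX.integral_received k n]
    simp [hαdef]
  have hpt : ∀ ω, ageAtStart (fun j => X j ω) a n (k + 1) ^ 2 ≤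
      (1 + α) * (ageAtStart (fun j => X j ω) a n k ^ 2 * (1 - received n (X k ω))) +
        (1 + 1 / α) * (X k ω).2.1 ^ 2 := fun ω => by
    rw [ageAtStart_succ]
    generalize ageAtStart (fun j => X j ω) a n k = A
    generalize (X k ω).2.1 = S
    have hα' : 0 < 1 / α := one_div_pos.2 hα
    simp only [received]
    split_ifs
    · nlinarith [mul_nonneg hα'.le (sq_nonneg S)]
    · have h : (1 + α) * (A ^ 2 * (1 - 0)) + (1 + 1 / α) * S ^ 2 - ((1 - 0) * A + S) ^ 2 =
          1 / α * (α * A - S) ^ 2 := by field_simp; ring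
      nlinarith [mul_nonneg hα'.le (sq_nonneg (α * A - S))]
  calc _ ≤ ∫ ω, ((1 + α) * (ageAtStart (fun j => X j ω) a n k ^ 2 *
        (1 - received n (X k ω))) + (1 + 1 / α) * (X k ω).2.1 ^ 2) ∂P :=
        integral_mono (hX.memLp_ageAtStart a n (k + 1)).integrable_sq
          ((hI.const_mul _).add ((hX.memLp_service k).integrable_sq.const_mul _)) hpt
    _ = _ := by
        rw [integral_add (hI.const_mul _) ((hX.memLp_service k).integrable_sq.const_mul _),
          integral_const_mul, integral_const_mul, hE, hX.integral_service_sq k]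
        ring

theorem IsPGAW.exists_integral_ageAtStart_sq_le (hX : IsPGAW P η p σ X) (a : ℝ) {n : Fin N}
    (hα : 0 < η n * (1 - p n)) :
    ∃ C, ∀ k, ∫ ω, ageAtStart (fun j => X j ω) a n k ^ 2 ∂P ≤ C := by
  have hα1 : η n * (1 - p n) ≤ 1 := by
    have h1 : η n ≤ 1 := by
      rw [← hX.prob_sum]
      exact Finset.single_le_sum (fun m _ => hX.prob_nonneg m) (Finset.mem_univ n)
    have := mul_le_mul h1 (sub_le_self 1 (hX.drop_nonneg n)) (sub_nonneg.2 (hX.drop_le_one n))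
      zero_le_one
    linarith
  have hQ : 0 ≤ slotSecondMoment η σ :=
    (integral_nonneg fun ω => sq_nonneg (X 0 ω).2.1).trans_eq (hX.integral_service_sq 0)
  have hstep := hX.integral_ageAtStart_sq_succ_le a hα
  set α := η n * (1 - p n)
  set B := (1 + 1 / α) * slotSecondMoment η σ
  have hB : 0 ≤ B := by positivity
  -- `B / α ^ 2` is the fixed point of `u ↦ (1 - α ^ 2) * u + B`; adding `a ^ 2` covers the initial
  -- age.
  refine ⟨a ^ 2 + B / α ^ 2, fun k => ?_⟩
  induction k with
  | zero =>
    simp only [ageAtStart, integral_const, probReal_univ, one_smul]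
    linarith [show 0 ≤ B / α ^ 2 by positivity]
  | succ k ih =>
    have h1 : 0 ≤ 1 - α ^ 2 := by nlinarith
    calc _ ≤ (1 - α ^ 2) * (a ^ 2 + B / α ^ 2) + B :=
          (hstep k).trans (add_le_add_left (mul_le_mul_of_nonneg_left ih h1) _)
      _ = a ^ 2 + B / α ^ 2 - α ^ 2 * a ^ 2 := by field_simp; ring
      _ ≤ a ^ 2 + B / α ^ 2 := sub_le_self _ (by positivity)

/-- The ages at the scheduling instances, weighted by centered functions of these instances,
average out. -/
theorem IsPGAW.tendsto_average_ageAtStart_mul (hX : IsPGAW P η p σ X) (a : ℝ) {n : Fin N}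
    (hα : 0 < η n * (1 - p n)) {v : Slot N → ℝ} (hv : Measurable v)
    (hv2 : ∀ k, MemLp (fun ω => v (X k ω)) 2 P) (hv0 : ∀ k, ∫ ω, v (X k ω) ∂P = 0) {V : ℝ}
    (hV : ∀ k, ∫ ω, v (X k ω) ^ 2 ∂P ≤ V) :
    ∀ᵐ ω ∂P, Tendsto (fun k : ℕ => (∑ j ∈ Finset.range k,
      ageAtStart (fun i => X i ω) a n j * v (X j ω)) / k) atTop (𝓝 0) := by
  obtain ⟨C, hC⟩ := hX.exists_integral_ageAtStart_sq_le a hα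
  have hmA := hX.measurable_ageAtStart_path a n
  have hind := hX.indepFun_ageAtStart a n
  have hm : ∀ k, Measurable fun ω => ageAtStart (fun i => X i ω) a n k * v (X k ω) :=
    fun k => (hmA k).mul (hv.comp (hX.measurable k))
  refine strong_law_of_orthogonal (C := C * V) (fun k => ?_) (fun j k hjk => ?_) fun k => ?_
  -- Independence of the two factors puts the product in L² without fourth moments.
  · refine (memLp_two_iff_integrable_sq (hm k).aestronglyMeasurable).2 ?_
    simp_rw [mul_pow]
    exact IndepFun.integrable_mul ((hind k).comp (measurable_id.pow_const 2) (hv.pow_const 2))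
      (hX.memLp_ageAtStart a n k).integrable_sq (hv2 k).integrable_sq
  -- All factors except `v (X k)` are determined by the slots before `k`, and `v (X k)` is centered.
  · have hF : Measurable fun x : ℕ → Slot N =>
        ageAtStart x a n j * v (x j) * ageAtStart x a n k :=
      ((measurable_ageAtStart a n j).mul (hv.comp (measurable_pi_apply j))).mul
        (measurable_ageAtStart a n k)
    have h := hX.indepFun_past (k := k) hF fun x y hxy => by
      rw [ageAtStart_congr a n hxy, ageAtStart_congr a n fun i hi => hxy i (hi.trans hjk),
        hxy j hjk]
    have h2 := h.integral_fun_comp_mul_comp (f := fun u => u) (g := v)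
      (hF.comp hX.measurable_path).aemeasurable (hX.measurable k).aemeasurable
      (by fun_prop) hv.aestronglyMeasurable
    rw [hv0 k, mul_zero] at h2
    rw [← h2]
    exact integral_congr_ae (ae_of_all _ fun ω => by ring)
  · simp_rw [mul_pow]
    rw [(hind k).integral_fun_comp_mul_comp (f := fun u => u ^ 2) (g := fun y => v y ^ 2)
      (hmA k).aemeasurable (hX.measurable k).aemeasurable
      (by fun_prop) (hv.pow_const 2).aestronglyMeasurable]
    exact mul_le_mul (hC k) (hV k) (integral_nonneg fun ω => sq_nonneg _)
      ((integral_nonneg fun ω => sq_nonneg _).trans (hC 0))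

/-- Removes the boundary term left by telescoping the age recursion. -/
theorem IsPGAW.tendsto_ageAtStart_div (hX : IsPGAW P η p σ X) (a : ℝ) {n : Fin N}
    (hα : 0 < η n * (1 - p n)) :
    ∀ᵐ ω ∂P, Tendsto (fun k : ℕ => ageAtStart (fun i => X i ω) a n k / k) atTop (𝓝 0) := by
  obtain ⟨C, hC⟩ := hX.exists_integral_ageAtStart_sq_le a hα
  refine ae_tendsto_zero_of_integral_sq_le (C := C)
    (Z := fun k ω => ageAtStart (fun i => X i ω) a n k / k) (fun k => ?_) fun k => ?_
  · simp_rw [div_eq_mul_inv]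
    exact (hX.memLp_ageAtStart a n k).mul_const _
  · simp_rw [div_pow]
    rw [integral_div]
    gcongr
    exact hC k

/-- The mean age of a source of a P-GAW scheduler. -/
theorem IsPGAW.hasMeanAoI (hX : IsPGAW P η p σ X) (a₀ : Fin N → ℝ≥0) {n : Fin N}
    (hα : 0 < η n * (1 - p n)) :
    HasMeanAoI P X a₀ n (slotMean η σ / (η n * (1 - p n)) +
      slotSecondMoment η σ / (2 * slotMean η σ)) := by
  have hm := hX.slotMean_pos
  set α := η n * (1 - p n) with hαdef
  set m := slotMean η σ with hmdef
  have hri : ∀ k, MemLp (fun ω => received n (X k ω)) 2 P := fun k =>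
    MemLp.of_bound ((measurable_received n).comp (hX.measurable k)).aestronglyMeasurable 1
      (ae_of_all _ fun ω => by simp only [received]; split_ifs <;> simp)
  have hrsq : ∀ k, ∫ ω, (received n (X k ω) - α) ^ 2 ∂P ≤ (1 + α) ^ 2 := fun k => by
    refine (integral_mono ((hri k).sub (memLp_const α)).integrable_sq
      (integrable_const ((1 + α) ^ 2)) fun ω => ?_).trans_eq (by simp)
    simp only [received, Pi.sub_apply]
    split_ifs <;> nlinarith
  have hssq : ∀ k, ∫ ω, ((X k ω).2.1 - m) ^ 2 ∂P ≤ slotSecondMoment η σ := fun k => by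
    have hexp : ∀ ω, ((X k ω).2.1 - m) ^ 2 = (X k ω).2.1 ^ 2 - (2 * m * (X k ω).2.1 - m ^ 2) :=
      fun ω => by ring
    have hI : Integrable (fun ω => 2 * m * (X k ω).2.1) P := (hX.integrable_service k).const_mul _
    simp_rw [hexp]
    rw [integral_sub (hX.memLp_service k).integrable_sq (by exact hI.sub (integrable_const _)),
      integral_sub hI (integrable_const _), integral_const_mul, hX.integral_service_sq k,
      hX.integral_service k]
    simp only [integral_const, probReal_univ, one_smul, ← hmdef]
    nlinarith
  have h1 := hX.tendsto_average_ageAtStart_mul (a₀ n) hα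
    ((measurable_received n).sub_const α) (fun k => (hri k).sub (memLp_const α)) (fun k => by
      rw [integral_sub ((hri k).integrable (by norm_num)) (integrable_const α),
        hX.integral_received k n]
      simp [hαdef]) hrsq
  have h2 := hX.tendsto_average_ageAtStart_mul (a₀ n) hα
    (measurable_service.sub_const m) (fun k => (hX.memLp_service k).sub (memLp_const m))
    (fun k => by
      rw [integral_sub (hX.integrable_service k) (integrable_const m), hX.integral_service k]
      simp [hmdef]) hssq
  have h3 := hX.tendsto_ageAtStart_div (a₀ n) hα
  have h4 := hX.tendsto_average_comp measurable_service (hX.integrable_service 0)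
  have h5 := hX.tendsto_average_comp (measurable_service.pow_const 2)
    (hX.memLp_service 0).integrable_sq
  rw [hX.integral_service 0] at h4
  rw [hX.integral_service_sq 0] at h5
  filter_upwards [h1, h2, h3, h4, h5, hX.ae_service_nonneg] with ω h1 h2 h3 h4 h5 hnn
  set x : ℕ → Slot N := fun k => X k ω with hx
  set A : ℕ → ℝ := ageAtStart x (a₀ n) n with hA
  -- The telescoped recursion `A (j + 1) - A j = S j - r j * A j`, with `r j` split as `α + (r j -
  -- α)`.
  have hrec : ∀ k, (∑ j ∈ Finset.range k, A j) * α = (∑ j ∈ Finset.range k, (x j).2.1) -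
      (∑ j ∈ Finset.range k, A j * (received n (x j) - α)) - (A k - a₀ n) := fun k => by
    induction k with
    | zero => simp [hA, ageAtStart]
    | succ k ih =>
      rw [Finset.sum_range_succ, Finset.sum_range_succ, Finset.sum_range_succ, add_mul, ih]
      simp only [hA, ageAtStart_succ]
      ring
  have hinv : Tendsto (fun k : ℕ => (a₀ n : ℝ) / k) atTop (𝓝 0) :=
    tendsto_const_div_atTop_nhds_zero_nat _
  have hAavg : Tendsto (fun k : ℕ => (∑ j ∈ Finset.range k, A j) / k) atTop (𝓝 (m / α)) := by
    have h := (((h4.sub h1).sub (h3.sub hinv))).div_const α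
    simp only [sub_zero] at h
    refine h.congr fun k => ?_
    rw [← sub_div, ← sub_div, ← sub_div, div_div, mul_comm (k : ℝ) α, ← div_div]
    congr 1
    rw [div_eq_iff hα.ne']
    exact (hrec k).symm
  -- Splitting `S j = m + (S j - m)` reduces the average of `A j * S j` to `m` times that of `A j`.
  have hfin : Tendsto (fun k : ℕ => (∑ j ∈ Finset.range k,
      (A j * (x j).2.1 + (x j).2.1 ^ 2 / 2)) / (k : ℝ)) atTop
      (𝓝 (m / α * m + slotSecondMoment η σ / 2)) := by
    have h := ((h2.add (hAavg.mul_const m)).add (h5.div_const 2))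
    rw [zero_add] at h
    refine h.congr fun k => ?_
    simp only [mul_sub, Finset.sum_sub_distrib, Finset.sum_add_distrib, ← Finset.sum_div,
      ← Finset.sum_mul]
    ring
  convert isTimeAverage_age hnn a₀ n hm h4 hfin using 1
  field_simp

end MeanAge

end PGAW

end

/-! ### Equality of the ages in the two systems -/

theorem mainTheorem8 {N : ℕ} (η p : Fin N → ℝ) (σ : Fin N → Measure ℝ)
    {Ω : Type*} [MeasurableSpace Ω] (P : Measure Ω) [IsProbabilityMeasure P]
    (X : ℕ → Ω → PGAW.Slot N) (hX : PGAW.IsPGAW P η p σ X)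
    (hη : ∀ n, 0 < η n) (hp : ∀ n, p n < 1)
    (w : Fin N → ℝ) (a₀ : Fin N → ℝ≥0) :
    -- successful transmissions and drops have the probabilities of the expanded system
    (∀ k n, P {ω | (X k ω).1 = n ∧ (X k ω).2.2 = false} =
        ENNReal.ofReal (PGAW.phantomProb η p n.castSucc)) ∧
    (∀ k, P {ω | (X k ω).2.2 = true} = ENNReal.ofReal (PGAW.phantomProb η p (Fin.last N))) ∧
    -- the dropped transmissions, seen as those of a phantom source, give a drop-free P-GAW system;
    -- the phantom service time (that of a transmission, given that it is dropped) has the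
    -- stated moments
    (0 < PGAW.phantomWeight η p →
      ∃ φ : Measure ℝ, PGAW.IsServiceLaw φ ∧
        (∀ k, (ProbabilityTheory.cond P {ω | (X k ω).2.2 = true}).map (fun ω => (X k ω).2.1) = φ) ∧
        PGAW.mean φ = PGAW.phantomMean η p σ ∧
        PGAW.secondMoment φ = PGAW.phantomSecondMoment η p σ ∧
        PGAW.IsPGAW P (PGAW.phantomProb η p) (fun _ => 0)
          (Fin.snoc σ φ : Fin (N + 1) → Measure ℝ) (fun k ω => PGAW.relabel (X k ω))) ∧
    -- the AoI of the system with drops equals that of every drop-free `(N+1)`-source P-GAW system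
    -- with the expanded selection probabilities and these service time moments
    ∃ a : Fin N → ℝ,
      (∀ n, PGAW.HasMeanAoI P X a₀ n (a n)) ∧
      PGAW.HasWeightedAoI P X a₀ w (∑ n, w n * a n) ∧
      ∀ {Ω' : Type*} [MeasurableSpace Ω'] (P' : Measure Ω') [IsProbabilityMeasure P']
        (σ' : Fin (N + 1) → Measure ℝ) (Y : ℕ → Ω' → PGAW.Slot (N + 1)) (b₀ : Fin (N + 1) → ℝ≥0),
        PGAW.IsPGAW P' (PGAW.phantomProb η p) (fun _ => 0) σ' Y →
        (∀ n : Fin N, PGAW.mean (σ' n.castSucc) = PGAW.mean (σ n)) →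
        (∀ n : Fin N, PGAW.secondMoment (σ' n.castSucc) = PGAW.secondMoment (σ n)) →
        (0 < PGAW.phantomWeight η p →
          PGAW.mean (σ' (Fin.last N)) = PGAW.phantomMean η p σ ∧
          PGAW.secondMoment (σ' (Fin.last N)) = PGAW.phantomSecondMoment η p σ) →
        (∀ n : Fin N, PGAW.HasMeanAoI P' Y b₀ n.castSucc (a n)) ∧
        PGAW.HasWeightedAoI P' Y b₀ (Fin.snoc w 0 : Fin (N + 1) → ℝ) (∑ n, w n * a n) := by
  refine ⟨hX.measure_received, hX.measure_dropped, fun hw => ⟨PGAW.phantomLaw η p σ,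
    PGAW.isServiceLaw_phantomLaw hX.prob_nonneg hX.drop_nonneg hX.service hw,
    hX.map_cond_dropped hw,
    PGAW.mean_phantomLaw hX.prob_nonneg hX.drop_nonneg hX.service hw,
    PGAW.secondMoment_phantomLaw hX.prob_nonneg hX.drop_nonneg hX.service hw, hX.expand hw⟩, ?_⟩
  have hα : ∀ n, 0 < η n * (1 - p n) := fun n => mul_pos (hη n) (sub_pos.2 (hp n))
  have hmean := fun n => hX.hasMeanAoI a₀ (hα n)
  -- The witness is the closed formula of `IsPGAW.hasMeanAoI`, free of initial ages, so `b₀` may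
  -- differ from `a₀`.
  refine ⟨_, hmean, PGAW.hasWeightedAoI_of_hasMeanAoI w hmean, ?_⟩
  intro Ω' _ P' _ σ' Y b₀ hY h1 h2 hlast
  have hm : PGAW.slotMean (PGAW.phantomProb η p) σ' = PGAW.slotMean η σ :=
    PGAW.sum_phantomProb_mul hX.prob_nonneg hX.drop_nonneg h1 fun hw => (hlast hw).1
  have hq : PGAW.slotSecondMoment (PGAW.phantomProb η p) σ' = PGAW.slotSecondMoment η σ :=
    PGAW.sum_phantomProb_mul hX.prob_nonneg hX.drop_nonneg h2 fun hw => (hlast hw).2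
  have hprob : ∀ n : Fin N, PGAW.phantomProb η p n.castSucc * (1 - 0) = η n * (1 - p n) :=
    fun n => by rw [PGAW.phantomProb, Fin.snoc_castSucc, sub_zero, mul_one]
  have hmean' : ∀ n : Fin N, PGAW.HasMeanAoI P' Y b₀ n.castSucc
      (PGAW.slotMean η σ / (η n * (1 - p n)) +
        PGAW.slotSecondMoment η σ / (2 * PGAW.slotMean η σ)) := fun n => by
    have h := hY.hasMeanAoI b₀ (n := n.castSucc) (by rw [hprob]; exact hα n)
    rwa [hm, hq, hprob] at h
  exact ⟨hmean', PGAW.hasWeightedAoI_snoc_zero w hmean'⟩
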